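/- Let $n \in \mathbb{N}$, let $M_n$ be the ring of complex $n \times n$ matrices, and for $X \in M_n$ let $\bar X$, $X^t$, $X^*$ denote the complex conjugate, the transpose and the conjugate transpose of $X$. Let $Q > 0$ be a real number. Let $\sigma \in S_n$ be an involution ($\sigma^{-1} = \sigma$) with at most one fixed point, and let $P_\sigma \in M_n$ be the corresponding permutation matrix, $(P_\sigma)_{ij} = \delta_{i,\sigma(j)}$. Then for every $V \in M_n$ such that $\operatorname{tr}(V^* V) = 1$ and $Q\, V \bar V$ is unitary, there exists a unitary matrix $g \in U(n)$ such that $$ g\, V\, g^t = D\, P_\sigma, \qquad D = \operatorname{diag}(z_1, \ldots, z_n), $$ where $z_1, \ldots, z_n \in \mathbb{C} \setminus \{0\}$ satisfy $$ \sum_{k=1}^n |z_k|^2 = 1, \qquad z_k\, z_{\sigma(k)} = Q^{-1} \quad \text{for all } k = 1, \ldots, n. $$ -/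

import Mathlib

open Matrix

open scoped InnerProductSpace ComplexConjugate

/-! ### Antilinear maps with unitary square -/

section AntilinearPairs

variable {E : Type*} [NormedAddCommGroup E] [InnerProductSpace ℂ E]

/-! Put `A = √Q V`, `J x = A x̄` and `K x = Aᵀ x̄`, so that `J²` is multiplication by the unitary `Q
V V̄`. The linear maps `K J` (positive) and `J²` (unitary) commute, hence share a unit eigenvector
`x` in any nonzero subspace stable under `J` and `K`. Either `x ⟂ J x`, and the two directions are
exchanged by `J` and `K`, or both eigenvalues are 1 and a fixed vector appears
(`exists_exchangedPair_or_fixed`). Two orthonormal fixed vectors `x`, `y` combine into the exchanged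
pair `(x ± i y)/√2`, so every stable subspace of dimension at least 2 contains an exchanged pair.

Splitting off one pair per 2-cycle of `σ`, and a fixed vector for its possible fixed point, gives an
orthonormal basis permuted by `J` along `σ` up to scalars (`exists_permuted_family`). The conjugates
of its vectors are the rows of `g`. -/

/-- `K` is the antilinear adjoint of `J`, and `J ∘ J` is unitary with inverse `K ∘ K`. -/
structure IsUnitarySquare (J K : E →ₛₗ[starRingEnd ℂ] E) : Prop where
  adjoint : ∀ x y, ⟪J x, y⟫_ℂ = ⟪K y, x⟫_ℂ
  left_inv : ∀ x, K (K (J (J x))) = x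
  right_inv : ∀ x, J (J (K (K x))) = x

/-- `W` is stable under both `J` and `K`. -/
def StableUnder (J K : E →ₛₗ[starRingEnd ℂ] E) (W : Submodule ℂ E) : Prop :=
  ∀ x ∈ W, J x ∈ W ∧ K x ∈ W

/-- The orthonormal vectors `e`, `f` are exchanged, up to scalars, by `J` and by `K`. -/
structure IsExchangedPair (J K : E →ₛₗ[starRingEnd ℂ] E) (e f : E) : Prop where
  norm_left : ‖e‖ = 1
  norm_right : ‖f‖ = 1
  inner_eq_zero : ⟪e, f⟫_ℂ = 0
  map_left : ∃ a : ℂ, J e = a • f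
  map_right : ∃ b : ℂ, J f = b • e
  adjoint_left : ∃ c : ℂ, K e = c • f
  adjoint_right : ∃ d : ℂ, K f = d • e

variable {J K : E →ₛₗ[starRingEnd ℂ] E} {W : Submodule ℂ E}

lemma exists_eigenvector_mem [FiniteDimensional ℂ E] (f : E →ₗ[ℂ] E) (hW : W ≠ ⊥)
    (hf : ∀ x ∈ W, f x ∈ W) : ∃ μ : ℂ, ∃ x ∈ W, x ≠ 0 ∧ f x = μ • x := by
  have : Nontrivial W := Submodule.nontrivial_iff_ne_bot.mpr hW
  obtain ⟨μ, hμ⟩ := Module.End.exists_eigenvalue (f.restrict hf)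
  obtain ⟨x, hx⟩ := hμ.exists_hasEigenvector
  refine ⟨μ, x, x.2, fun h => hx.2 (Subtype.ext h), ?_⟩
  have := congrArg Subtype.val hx.apply_eq_smul
  simpa using this

lemma exists_common_eigenvector_mem [FiniteDimensional ℂ E] (f g : E →ₗ[ℂ] E) (hW : W ≠ ⊥)
    (hf : ∀ x ∈ W, f x ∈ W) (hg : ∀ x ∈ W, g x ∈ W) (hfg : ∀ x, f (g x) = g (f x)) :
    ∃ μ ν : ℂ, ∃ x ∈ W, ‖x‖ = 1 ∧ f x = μ • x ∧ g x = ν • x := by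
  obtain ⟨μ, x, hxW, hx, hfx⟩ := exists_eigenvector_mem f hW hf
  have hne : W ⊓ Module.End.eigenspace f μ ≠ ⊥ := fun h => hx <| by
    have : x ∈ W ⊓ Module.End.eigenspace f μ := ⟨hxW, Module.End.mem_eigenspace_iff.mpr hfx⟩
    simpa [h] using this
  obtain ⟨ν, y, hy, hy0, hgy⟩ := exists_eigenvector_mem g hne fun z hz =>
    ⟨hg z hz.1, Module.End.mem_eigenspace_iff.mpr <| by
      rw [hfg, Module.End.mem_eigenspace_iff.mp hz.2, map_smul]⟩
  have hfy := Module.End.mem_eigenspace_iff.mp hy.2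
  refine ⟨μ, ν, ((‖y‖ : ℂ)⁻¹) • y, W.smul_mem _ hy.1, ?_, ?_, ?_⟩
  · have := norm_ne_zero_iff.mpr hy0
    simp [norm_smul, this]
  · rw [map_smul, hfy, smul_comm]
  · rw [map_smul, hgy, smul_comm]

namespace IsUnitarySquare

variable (h : IsUnitarySquare J K)
include h

lemma inner_map_map (x y : E) : ⟪J (J x), J (J y)⟫_ℂ = ⟪x, y⟫_ℂ := by
  rw [h.adjoint, ← inner_conj_symm, h.adjoint, h.left_inv, inner_conj_symm]

lemma norm_map_map (x : E) : ‖J (J x)‖ = ‖x‖ := by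
  rw [@norm_eq_sqrt_re_inner ℂ, @norm_eq_sqrt_re_inner ℂ E _ _ _ x, h.inner_map_map]

lemma map_eq_zero {x : E} (hx : J x = 0) : x = 0 := by
  rw [← h.left_inv x, hx]; simp

lemma adjoint_comm (x : E) : K (J (J x)) = J (J (K x)) := by
  rw [← h.right_inv (K (J (J x))), h.left_inv]

lemma inner_adjoint_map (x : E) : ⟪K (J x), x⟫_ℂ = (‖J x‖ : ℂ) ^ 2 := by
  rw [← h.adjoint, inner_self_eq_norm_sq_to_K]; rfl

/-- A common eigenvector `x` of `K J` and `J²` makes `K x` proportional to `J x`, so the span of `x`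
and `J x` is stable; the dichotomy is whether `x ⟂ J x`. -/
lemma exists_exchangedPair_or_fixed [FiniteDimensional ℂ E] (hW : StableUnder J K W)
    (hne : W ≠ ⊥) :
    (∃ e ∈ W, ∃ f ∈ W, IsExchangedPair J K e f) ∨
      ∃ e ∈ W, ‖e‖ = 1 ∧ J e = e ∧ K e = e := by
  obtain ⟨l, ω, x, hxW, hx, hP, hU⟩ := exists_common_eigenvector_mem
    (K.comp J : E →ₗ[ℂ] E) (J.comp J : E →ₗ[ℂ] E) hne
    (fun x hx => (hW _ (hW x hx).1).2) (fun x hx => (hW _ (hW x hx).1).1)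
    (fun x => h.adjoint_comm (J x))
  simp only [LinearMap.comp_apply] at hP hU
  have hω : ‖ω‖ = 1 := by simpa [hU, norm_smul, hx] using h.norm_map_map x
  have hω0 : ω ≠ 0 := by rintro rfl; simp at hω
  have hx0 : x ≠ 0 := by rintro rfl; simp at hx
  have hJ0 : ‖J x‖ ≠ 0 := fun hz => hx0 (h.map_eq_zero (norm_eq_zero.mp hz))
  have hl : l = (‖J x‖ : ℂ) ^ 2 := by
    have := h.inner_adjoint_map x
    rw [hP, inner_smul_left, inner_self_eq_norm_sq_to_K, hx] at this
    have h2 := congrArg conj this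
    simpa using h2
  have hl0 : l ≠ 0 := by rw [hl]; exact pow_ne_zero _ (by exact_mod_cast hJ0)
  have hωc : conj ω ≠ 0 := (map_ne_zero _).mpr hω0
  have hlc : conj l ≠ 0 := (map_ne_zero _).mpr hl0
  -- Evaluating `K² J² = 1` at `J x` gives `l̄ ω̄ K x = J x`.
  have hKx : K x = ((conj l)⁻¹ * (conj ω)⁻¹) • J x := by
    have h1 := h.left_inv (J x)
    rw [hU, map_smulₛₗ, map_smulₛₗ, map_smulₛₗ, hP, map_smulₛₗ] at h1
    rw [← h1, smul_smul, smul_smul, Complex.conj_conj,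
      show (conj l)⁻¹ * (conj ω)⁻¹ * conj ω * conj l = 1 by field_simp, one_smul]
  by_cases hxJ : ⟪x, J x⟫_ℂ = 0
  · left
    have hr : (‖J x‖ : ℂ) ≠ 0 := by exact_mod_cast hJ0
    refine ⟨x, hxW, (‖J x‖ : ℂ)⁻¹ • J x, W.smul_mem _ (hW x hxW).1, hx, ?_, ?_,
      ⟨‖J x‖, ?_⟩, ⟨(‖J x‖ : ℂ)⁻¹ * ω, ?_⟩, ⟨(conj l)⁻¹ * (conj ω)⁻¹ * ‖J x‖, ?_⟩,
      ⟨(‖J x‖ : ℂ)⁻¹ * l, ?_⟩⟩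
    · simp [norm_smul, hJ0]
    · rw [inner_smul_right, hxJ, mul_zero]
    · rw [smul_smul, mul_inv_cancel₀ hr, one_smul]
    · rw [map_smulₛₗ, hU, smul_smul]; simp
    · rw [hKx, smul_smul, mul_assoc, mul_inv_cancel₀ hr, mul_one]
    · rw [map_smulₛₗ, hP, smul_smul]; simp
  · right
    -- The adjoint relation at `J x`, `J x` equates the two eigenvalues once `⟪x, J x⟫ ≠ 0`; as `l >
    -- 0` and `|ω| = 1`, both are 1.
    have hlω : conj l = conj ω := by
      have h1 : ⟪K (J x), J x⟫_ℂ = ⟪J (J x), J x⟫_ℂ := (h.adjoint _ _).symm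
      rw [hP, hU, inner_smul_left, inner_smul_left] at h1
      exact mul_right_cancel₀ hxJ h1
    have hlω : l = ω := (starRingEnd ℂ).injective hlω
    have hl1 : l = 1 := by
      have h1 : ‖J x‖ ^ 2 = 1 := by
        have := hω
        rw [← hlω, hl] at this
        simpa using this
      rw [hl]; exact_mod_cast h1
    rw [← hlω, hl1] at hU hKx
    simp only [map_one, inv_one, mul_one, one_smul] at hU hKx
    rw [hl1, one_smul] at hP
    obtain ⟨y, hyW, hy0, hJy, hKy⟩ : ∃ y ∈ W, y ≠ 0 ∧ J y = y ∧ K y = y := by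
      by_cases hy : x + J x = 0
      · have hJx : J x = -x := (neg_eq_of_add_eq_zero_right hy).symm
        -- When `J x = -x`, antilinearity turns the sign around on `i x`.
        refine ⟨Complex.I • x, W.smul_mem _ hxW, smul_ne_zero Complex.I_ne_zero hx0, ?_, ?_⟩
        · rw [map_smulₛₗ, hJx]; simp
        · rw [map_smulₛₗ, hKx, hJx]; simp
      · refine ⟨x + J x, W.add_mem hxW (hW x hxW).1, hy, ?_, ?_⟩
        · rw [map_add, hU, add_comm]
        · rw [map_add, hP, hKx, add_comm]
    have := norm_ne_zero_iff.mpr hy0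
    refine ⟨(‖y‖ : ℂ)⁻¹ • y, W.smul_mem _ hyW, by simp [norm_smul, this], ?_, ?_⟩
    · rw [map_smulₛₗ, hJy]; simp
    · rw [map_smulₛₗ, hKy]; simp

/-- The part of a stable subspace orthogonal to a stable subspace is stable. -/
lemma stableUnder_inf_orthogonal {W' : Submodule ℂ E} (hW : StableUnder J K W)
    (hW' : StableUnder J K W') : StableUnder J K (W'ᗮ ⊓ W) := by
  refine fun x hx => ⟨⟨(Submodule.mem_orthogonal' _ _).mpr fun u hu => ?_, (hW x hx.2).1⟩,
    ⟨(Submodule.mem_orthogonal' _ _).mpr fun u hu => ?_, (hW x hx.2).2⟩⟩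
  · rw [h.adjoint]
    exact (Submodule.mem_orthogonal _ _).mp hx.1 _ (hW' u hu).2
  · rw [← h.adjoint]
    exact (Submodule.mem_orthogonal _ _).mp hx.1 _ (hW' u hu).1

lemma exists_exchangedPair [FiniteDimensional ℂ E] (hW : StableUnder J K W)
    (hrank : 2 ≤ Module.finrank ℂ W) : ∃ e ∈ W, ∃ f ∈ W, IsExchangedPair J K e f := by
  have hne : W ≠ ⊥ := by rintro rfl; simp at hrank
  obtain hp | ⟨x, hxW, hx, hJx, hKx⟩ := h.exists_exchangedPair_or_fixed hW hne
  · exact hp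
  have hx0 : x ≠ 0 := by rintro rfl; simp at hx
  have hspan : StableUnder J K (ℂ ∙ x) := fun y hy => by
    obtain ⟨a, rfl⟩ := Submodule.mem_span_singleton.mp hy
    rw [map_smulₛₗ, map_smulₛₗ, hJx, hKx]
    exact ⟨Submodule.smul_mem _ _ (Submodule.mem_span_singleton_self x),
      Submodule.smul_mem _ _ (Submodule.mem_span_singleton_self x)⟩
  have hne' : (ℂ ∙ x)ᗮ ⊓ W ≠ ⊥ := fun hbot => by
    have := Submodule.finrank_add_inf_finrank_orthogonal
      ((Submodule.span_singleton_le_iff_mem x W).mpr hxW)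
    rw [hbot, finrank_bot, finrank_span_singleton hx0] at this
    omega
  obtain ⟨e, he, f, hf, hef⟩ | ⟨y, hyW, hy, hJy, hKy⟩ :=
    h.exists_exchangedPair_or_fixed (h.stableUnder_inf_orthogonal hW hspan) hne'
  · exact ⟨e, he.2, f, hf.2, hef⟩
  have hxy : ⟪x, y⟫_ℂ = 0 :=
    (Submodule.mem_orthogonal _ _).mp hyW.1 x (Submodule.mem_span_singleton_self x)
  have hyx : ⟪y, x⟫_ℂ = 0 := inner_eq_zero_symm.mp hxy
  have hs : (‖((√2 : ℝ) : ℂ)‖) = √2 := by simp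
  have hxx : ⟪x, x⟫_ℂ = 1 := by rw [inner_self_eq_norm_sq_to_K, hx]; simp
  have hyy : ⟪y, y⟫_ℂ = 1 := by rw [inner_self_eq_norm_sq_to_K, hy]; simp
  have hnorm : ∀ c : ℂ, ‖c‖ = 1 → ‖((√2 : ℝ) : ℂ)⁻¹ • (x + c • y)‖ = 1 := fun c hc => by
    have h1 : ‖x + c • y‖ * ‖x + c • y‖ = 2 := by
      rw [norm_add_sq_eq_norm_sq_add_norm_sq_of_inner_eq_zero (𝕜 := ℂ) x (c • y)
        (by rw [inner_smul_right, hxy, mul_zero]), norm_smul, hx, hy, hc]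
      norm_num
    have h2 : ‖x + c • y‖ = √2 := by rw [← h1, Real.sqrt_mul_self (norm_nonneg _)]
    rw [norm_smul, norm_inv, hs, h2, inv_mul_cancel₀ (by positivity)]
  -- Antilinearity sends `x + i y` to `x - i y`, and these are orthogonal because `x`, `y` are
  -- orthonormal.
  refine ⟨((√2 : ℝ) : ℂ)⁻¹ • (x + Complex.I • y), W.smul_mem _ (W.add_mem hxW (W.smul_mem _ hyW.2)),
    ((√2 : ℝ) : ℂ)⁻¹ • (x + (-Complex.I) • y), W.smul_mem _ (W.add_mem hxW (W.smul_mem _ hyW.2)),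
    hnorm _ (by simp), hnorm _ (by simp), ?_, ⟨1, ?_⟩, ⟨1, ?_⟩, ⟨1, ?_⟩, ⟨1, ?_⟩⟩
  · simp only [inner_smul_left, inner_smul_right, inner_add_left, inner_add_right, hxy, hyx, hxx,
      hyy, map_inv₀, Complex.conj_ofReal, Complex.conj_I]
    linear_combination ((√2 : ℝ) : ℂ)⁻¹ ^ 2 * Complex.I_sq
  all_goals simp [map_smulₛₗ, hJx, hJy, hKx, hKy]

/-- A line has no room for two orthonormal vectors, which excludes the exchanged pair. -/
lemma exists_fixed [FiniteDimensional ℂ E] (hW : StableUnder J K W)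
    (hrank : Module.finrank ℂ W = 1) : ∃ e ∈ W, ‖e‖ = 1 ∧ J e = e := by
  have hne : W ≠ ⊥ := by rintro rfl; simp at hrank
  obtain ⟨e, he, f, hf, hef⟩ | ⟨x, hxW, hx, hJx, -⟩ := h.exists_exchangedPair_or_fixed hW hne
  · have he0 : e ≠ 0 := by rintro rfl; simpa using hef.norm_left
    obtain ⟨c, hc⟩ := (finrank_eq_one_iff_of_nonzero' (⟨e, he⟩ : W)
      (fun hz => he0 (congrArg Subtype.val hz))).mp hrank ⟨f, hf⟩
    have hc : c • e = f := congrArg Subtype.val hc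
    have h0 := hef.inner_eq_zero
    rw [← hc, inner_smul_right, inner_self_eq_norm_sq_to_K, hef.norm_left] at h0
    have hc0 : c = 0 := by simpa using h0
    have := hef.norm_right
    rw [← hc, hc0] at this
    simp at this
  · exact ⟨x, hxW, hx, hJx⟩

end IsUnitarySquare

namespace IsExchangedPair

variable {e f : E}

lemma stableUnder_span (hef : IsExchangedPair J K e f) :
    StableUnder J K (Submodule.span ℂ {e, f}) := fun x hx => by
  obtain ⟨s, t, rfl⟩ := Submodule.mem_span_pair.mp hx
  obtain ⟨a, ha⟩ := hef.map_left
  obtain ⟨b, hb⟩ := hef.map_right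
  obtain ⟨c, hc⟩ := hef.adjoint_left
  obtain ⟨d, hd⟩ := hef.adjoint_right
  have he : e ∈ Submodule.span ℂ {e, f} := Submodule.subset_span (by simp)
  have hf : f ∈ Submodule.span ℂ {e, f} := Submodule.subset_span (by simp)
  simp only [map_add, map_smulₛₗ, ha, hb, hc, hd]
  exact ⟨add_mem (Submodule.smul_mem _ _ (Submodule.smul_mem _ _ hf))
      (Submodule.smul_mem _ _ (Submodule.smul_mem _ _ he)),
    add_mem (Submodule.smul_mem _ _ (Submodule.smul_mem _ _ hf))
      (Submodule.smul_mem _ _ (Submodule.smul_mem _ _ he))⟩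

lemma finrank_span (hef : IsExchangedPair J K e f) :
    Module.finrank ℂ (Submodule.span ℂ {e, f}) = 2 := by
  have hli : LinearIndependent ℂ ![e, f] := by
    apply Orthonormal.linearIndependent
    rw [orthonormal_iff_ite]
    intro i j
    have := hef.inner_eq_zero
    have := inner_eq_zero_symm.mp hef.inner_eq_zero
    fin_cases i <;> fin_cases j <;>
      simp_all [inner_self_eq_norm_sq_to_K, hef.norm_left, hef.norm_right]
  have := finrank_span_eq_card hli
  rwa [Matrix.range_cons_cons_empty, Fintype.card_fin] at this

/-- After a change of phase the two scalars of an exchanged pair are inverse to each other. -/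
lemma exists_normalized (h : IsUnitarySquare J K) (hef : IsExchangedPair J K e f) :
    ∃ f', ∃ a b : ℂ, (∃ c : ℂ, f' = c • f) ∧ ‖f'‖ = 1 ∧ J e = a • f' ∧ J f' = b • e ∧
      a * b = 1 := by
  obtain ⟨a, ha⟩ := hef.map_left
  obtain ⟨b, hb⟩ := hef.map_right
  have hab : ‖a * b‖ = 1 := by
    have := h.norm_map_map e
    rw [ha, map_smulₛₗ, hb, smul_smul, norm_smul, hef.norm_left] at this
    simpa using this
  -- Replacing `f` by `t f` multiplies both scalars by `t̄`, so their product becomes `a b t̄² =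
  -- |t|⁴ = 1` when `t² = a b`.
  obtain ⟨t, ht⟩ := IsAlgClosed.exists_pow_nat_eq (a * b) (n := 2) (by norm_num)
  have htn : ‖t‖ = 1 := by
    have : ‖t‖ ^ 2 = 1 := by rw [← norm_pow, ht, hab]
    exact (pow_eq_one_iff_of_nonneg (norm_nonneg _) (by norm_num)).mp this
  have ht1 : t * conj t = 1 := by rw [Complex.mul_conj']; simp [htn]
  refine ⟨t • f, a * conj t, conj t * b, ⟨t, rfl⟩, by rw [norm_smul, htn, hef.norm_right, one_mul],
    ?_, ?_, ?_⟩
  · rw [ha, smul_smul, mul_assoc, mul_comm (conj t), ht1, mul_one]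
  · rw [map_smulₛₗ, hb, smul_smul]
  · linear_combination (-(conj t) ^ 2) * ht + (t * conj t + 1) * ht1

end IsExchangedPair

/-- An orthonormal family indexed by `s` whose members are permuted by `J` along an involution `σ`
with at most one fixed point, up to scalars that are inverse to each other along `σ`. -/
lemma IsUnitarySquare.exists_permuted_family [FiniteDimensional ℂ E] (h : IsUnitarySquare J K)
    {ι : Type*} [DecidableEq ι] (σ : Equiv.Perm ι) (hσ : Function.Involutive σ)
    (hfix : ∀ i j, σ i = i → σ j = j → i = j) (s : Finset ι) :
    (∀ k ∈ s, σ k ∈ s) → ∀ W : Submodule ℂ E, StableUnder J K W → Module.finrank ℂ W = s.card →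
    ∃ (e : ι → E) (z : ι → ℂ), (∀ k ∈ s, e k ∈ W) ∧
      (∀ i ∈ s, ∀ j ∈ s, ⟪e i, e j⟫_ℂ = if i = j then 1 else 0) ∧
      (∀ k ∈ s, J (e k) = z (σ k) • e (σ k)) ∧ ∀ k ∈ s, z k * z (σ k) = 1 := by
  induction s using Finset.strongInduction with
  | H s ih =>
  intro hs W hW hrank
  by_cases hex : ∃ k ∈ s, σ k ≠ k
  · obtain ⟨k, hk, hσk⟩ := hex
    have hk' := hs k hk
    have hcard : (({k, σ k} : Finset ι)).card = 2 := Finset.card_pair hσk.symm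
    have hsub : ({k, σ k} : Finset ι) ⊆ s := by
      simp [Finset.insert_subset_iff, hk, hk']
    have hcard' := Finset.card_sdiff_add_card_eq_card hsub
    have hmem : ∀ i, i ∈ s \ {k, σ k} ↔ i ∈ s ∧ i ≠ k ∧ i ≠ σ k := by simp
    obtain ⟨u, hu, v, hv, huv⟩ := h.exists_exchangedPair hW (by omega)
    obtain ⟨w, a, b, ⟨c, hc⟩, hw, hJu, hJw, hab⟩ := huv.exists_normalized h
    have hle : Submodule.span ℂ {u, v} ≤ W :=
      Submodule.span_le.mpr (by simp [Set.insert_subset_iff, hu, hv])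
    have hfr := Submodule.finrank_add_inf_finrank_orthogonal hle
    rw [huv.finrank_span] at hfr
    obtain ⟨e, z, heW, hee, hJe, hz⟩ := ih (s \ {k, σ k})
      (Finset.sdiff_ssubset hsub ⟨k, by simp⟩)
      (fun i hi => by
        rw [hmem] at hi ⊢
        exact ⟨hs i hi.1, fun hik => hi.2.2 (by rw [← hik, hσ i]),
          fun hik => hi.2.1 (σ.injective hik)⟩)
      _ (h.stableUnder_inf_orthogonal hW huv.stableUnder_span) (by omega)
    have hus : u ∈ Submodule.span ℂ {u, v} := Submodule.subset_span (by simp)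
    have hws : w ∈ Submodule.span ℂ {u, v} := by
      rw [hc]; exact Submodule.smul_mem _ _ (Submodule.subset_span (by simp))
    have hue : ∀ i ∈ s \ {k, σ k}, ⟪u, e i⟫_ℂ = 0 := fun i hi =>
      (Submodule.mem_orthogonal _ _).mp (heW i hi).1 u hus
    have hwe : ∀ i ∈ s \ {k, σ k}, ⟪w, e i⟫_ℂ = 0 := fun i hi =>
      (Submodule.mem_orthogonal _ _).mp (heW i hi).1 w hws
    have hue' : ∀ i ∈ s \ {k, σ k}, ⟪e i, u⟫_ℂ = 0 := fun i hi =>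
      inner_eq_zero_symm.mp (hue i hi)
    have hwe' : ∀ i ∈ s \ {k, σ k}, ⟪e i, w⟫_ℂ = 0 := fun i hi =>
      inner_eq_zero_symm.mp (hwe i hi)
    have huw : ⟪u, w⟫_ℂ = 0 := by rw [hc, inner_smul_right, huv.inner_eq_zero, mul_zero]
    have hwu : ⟪w, u⟫_ℂ = 0 := inner_eq_zero_symm.mp huw
    have huu : ⟪u, u⟫_ℂ = 1 := by rw [inner_self_eq_norm_sq_to_K, huv.norm_left]; simp
    have hww : ⟪w, w⟫_ℂ = 1 := by rw [inner_self_eq_norm_sq_to_K, hw]; simp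
    have hcases : ∀ i ∈ s, i = k ∨ i = σ k ∨ (i ∈ s \ {k, σ k} ∧ i ≠ k ∧ i ≠ σ k) := by
      intro i hi; rw [hmem]; tauto
    have hσσ : σ (σ k) = k := hσ k
    have hσne : ∀ i, i ≠ k → i ≠ σ k → σ i ≠ k ∧ σ i ≠ σ k := fun i h1 h2 =>
      ⟨fun hik => h2 (by rw [← hik, hσ i]), fun hik => h1 (σ.injective hik)⟩
    -- The scalar at `i` belongs to the image vector: `J u = a w` puts `a` at `σ k`, and `J w = b u`
    -- puts `b` at `k`.
    refine ⟨fun i => if i = k then u else if i = σ k then w else e i,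
      fun i => if i = k then b else if i = σ k then a else z i, ?_, ?_, ?_, ?_⟩
    · intro i hi
      obtain rfl | rfl | ⟨hi', h1, h2⟩ := hcases i hi
      · simpa using hu
      · simpa [hσk] using hle hws
      · simpa [h1, h2] using (heW i hi').2
    · intro i hi j hj
      obtain rfl | rfl | ⟨hi', h1, h2⟩ := hcases i hi <;>
        obtain rfl | rfl | ⟨hj', h3, h4⟩ := hcases j hj
      · simpa using huu
      · simpa [hσk, hσk.symm] using huw
      · simpa [h3, h4, h3.symm] using hue j hj'
      · simpa [hσk] using hwu
      · simpa [hσk] using hww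
      · simpa [hσk, h3, h4, h4.symm] using hwe j hj'
      · simpa [h1, h2] using hue' i hi'
      · simpa [hσk, h1, h2] using hwe' i hi'
      · simpa [h1, h2, h3, h4] using hee i hi' j hj'
    · intro i hi
      obtain rfl | rfl | ⟨hi', h1, h2⟩ := hcases i hi
      · simpa [hσk] using hJu
      · simpa [hσk, hσσ] using hJw
      · simpa [h1, h2, hσne i h1 h2] using hJe i hi'
    · intro i hi
      obtain rfl | rfl | ⟨hi', h1, h2⟩ := hcases i hi
      · simpa [hσk, mul_comm] using hab
      · simpa [hσk, hσσ] using hab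
      · simpa [h1, h2, hσne i h1 h2] using hz i hi'
  -- Every index left is fixed by `σ`, so at most one is left.
  · push Not at hex
    obtain rfl | ⟨k, hk⟩ := s.eq_empty_or_nonempty
    · exact ⟨0, 0, by simp, by simp, by simp, by simp⟩
    obtain rfl : s = {k} := Finset.eq_singleton_iff_unique_mem.mpr
      ⟨hk, fun i hi => hfix i k (hex i hi) (hex k hk)⟩
    obtain ⟨u, hu, hnu, hJu⟩ := h.exists_fixed hW (by simpa using hrank)
    exact ⟨fun _ => u, 1, by simpa using hu, by simp [inner_self_eq_norm_sq_to_K, hnu],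
      by simpa using hJu, by simp⟩

end AntilinearPairs

/-! ### Translation to matrices -/

section MatrixModel

variable {ι : Type*} [Fintype ι]

/-- The antilinear map `x ↦ A x̄` of Euclidean space attached to a complex matrix `A`. -/
noncomputable def conjMulVec (A : Matrix ι ι ℂ) :
    EuclideanSpace ℂ ι →ₛₗ[starRingEnd ℂ] EuclideanSpace ℂ ι where
  toFun x := WithLp.toLp 2 (A *ᵥ star (WithLp.ofLp x))
  map_add' x y := by simp [mulVec_add]
  map_smul' c x := by simp [mulVec_smul]

lemma ofLp_conjMulVec (A : Matrix ι ι ℂ) (x : EuclideanSpace ℂ ι) :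
    WithLp.ofLp (conjMulVec A x) = A *ᵥ star (WithLp.ofLp x) := rfl

lemma inner_conjMulVec (A : Matrix ι ι ℂ) (x y : EuclideanSpace ℂ ι) :
    ⟪conjMulVec A x, y⟫_ℂ = ⟪conjMulVec Aᵀ y, x⟫_ℂ := by
  rw [EuclideanSpace.inner_eq_star_dotProduct, EuclideanSpace.inner_eq_star_dotProduct,
    ofLp_conjMulVec, ofLp_conjMulVec, star_mulVec, star_mulVec, star_star, star_star,
    dotProduct_comm, ← dotProduct_mulVec, ← mulVec_transpose]
  rfl

lemma ofLp_conjMulVec_conjMulVec (A : Matrix ι ι ℂ) (x : EuclideanSpace ℂ ι) :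
    WithLp.ofLp (conjMulVec A (conjMulVec A x)) =
      (A * A.map (starRingEnd ℂ)) *ᵥ WithLp.ofLp x := by
  rw [ofLp_conjMulVec, ofLp_conjMulVec, star_mulVec, star_star, ← mulVec_transpose,
    mulVec_mulVec]
  rfl

lemma isUnitarySquare_conjMulVec [DecidableEq ι] {A : Matrix ι ι ℂ}
    (hA : A * A.map (starRingEnd ℂ) ∈ unitaryGroup ι ℂ) :
    IsUnitarySquare (conjMulVec A) (conjMulVec Aᵀ) := by
  have hT : Aᵀ * Aᵀ.map (starRingEnd ℂ) = star (A * A.map (starRingEnd ℂ)) := by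
    rw [star_eq_conjTranspose, conjTranspose_mul]
    congr 1
    ext i j
    simp
  refine ⟨inner_conjMulVec A, fun x => ?_, fun x => ?_⟩ <;> apply WithLp.ofLp_injective
  · rw [ofLp_conjMulVec_conjMulVec, ofLp_conjMulVec_conjMulVec, mulVec_mulVec, hT,
      mem_unitaryGroup_iff'.mp hA, one_mulVec]
  · rw [ofLp_conjMulVec_conjMulVec, ofLp_conjMulVec_conjMulVec, mulVec_mulVec, hT,
      mem_unitaryGroup_iff.mp hA, one_mulVec]

/-- Unitary congruence of `A` to a monomial matrix. -/
lemma exists_unitary_congruence [DecidableEq ι] {A : Matrix ι ι ℂ}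
    (hA : A * A.map (starRingEnd ℂ) ∈ unitaryGroup ι ℂ) (σ : Equiv.Perm ι)
    (hσ : Function.Involutive σ) (hfix : ∀ i j, σ i = i → σ j = j → i = j) :
    ∃ g ∈ unitaryGroup ι ℂ, ∃ z : ι → ℂ, g * A * gᵀ = diagonal z * σ.permMatrix ℂ ∧
      ∀ k, z k * z (σ k) = 1 := by
  obtain ⟨e, z, -, hee, hJe, hz⟩ :=
    (isUnitarySquare_conjMulVec hA).exists_permuted_family σ hσ hfix Finset.univ (by simp) ⊤
      (fun _ _ => ⟨trivial, trivial⟩) (by simp)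
  -- With conjugated rows, column `k` of `A gᵀ` is `A` applied to the conjugate of `e k`, that is `J
  -- (e k)`.
  set g : Matrix ι ι ℂ := of fun k i => star (e k i) with hg
  have hgu : g * star g = 1 := by
    ext i j
    have := hee i (Finset.mem_univ i) j (Finset.mem_univ j)
    rw [PiLp.inner_apply] at this
    rw [mul_apply, one_apply, ← this]
    refine Finset.sum_congr rfl fun k _ => ?_
    simp [hg, mul_comm]
  have hgu' : star g * g = 1 := mul_eq_one_comm.mp hgu
  refine ⟨g, mem_unitaryGroup_iff.mpr hgu, z, ?_, fun k => hz k (Finset.mem_univ k)⟩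
  have key : A * gᵀ = star g * (diagonal z * σ.permMatrix ℂ) := by
    ext i k
    have h1 := congrArg (fun v : EuclideanSpace ℂ ι => v i) (hJe k (Finset.mem_univ k))
    have h2 : (A * gᵀ) i k = conjMulVec A (e k) i := rfl
    rw [h2, h1, mul_apply, Finset.sum_eq_single (σ k)]
    · simp [hg, Equiv.Perm.permMatrix, PEquiv.toMatrix_apply, hσ k, diagonal_mul, mul_comm]
    · intro j _ hj
      have : σ j ≠ k := fun hjk => hj (by rw [← hjk, hσ j])
      simp [Equiv.Perm.permMatrix, PEquiv.toMatrix_apply, diagonal_mul, this]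
    · simp
  rw [mul_assoc, key, ← mul_assoc, hgu, one_mul]

end MatrixModel

/-! ### Rescaling by `√Q` and the trace condition -/

theorem mainTheorem1 (n : ℕ) (Q : ℝ) (hQ : 0 < Q)
    (σ : Equiv.Perm (Fin n)) (hσ : Function.Involutive σ)
    (hfix : ∀ i j : Fin n, σ i = i → σ j = j → i = j)
    (V : Matrix (Fin n) (Fin n) ℂ)
    (htr : Matrix.trace (Vᴴ * V) = 1)
    (hV : (Q : ℂ) • (V * V.map (starRingEnd ℂ)) ∈ Matrix.unitaryGroup (Fin n) ℂ) :
    ∃ g ∈ Matrix.unitaryGroup (Fin n) ℂ, ∃ z : Fin n → ℂ,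
      g * V * gᵀ = Matrix.diagonal z * σ.permMatrix ℂ ∧
      (∀ k, z k ≠ 0) ∧
      ∑ k, ‖z k‖ ^ 2 = (1 : ℝ) ∧
      ∀ k, z k * z (σ k) = (Q : ℂ)⁻¹ := by
  have hQ0 : (Q : ℂ) ≠ 0 := by exact_mod_cast hQ.ne'
  set q : ℂ := ((√Q : ℝ) : ℂ) with hq
  have hqq : q * q = Q := by rw [hq]; exact_mod_cast Real.mul_self_sqrt hQ.le
  have hq0 : q ≠ 0 := fun h0 => hQ0 (by rw [← hqq, h0, mul_zero])
  have hmap : (q • V) * (q • V).map (starRingEnd ℂ) = (Q : ℂ) • (V * V.map (starRingEnd ℂ)) := by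
    have : (q • V).map (starRingEnd ℂ) = q • V.map (starRingEnd ℂ) := by
      ext i j; simp [hq]
    rw [this, smul_mul_smul_comm, hqq]
  obtain ⟨g, hg, w, hgw, hw⟩ := exists_unitary_congruence (hmap ▸ hV) σ hσ hfix
  have hgz : g * V * gᵀ = diagonal (q⁻¹ • w) * σ.permMatrix ℂ := by
    have : diagonal (q⁻¹ • w) = q⁻¹ • diagonal w := diagonal_smul _ _
    rw [this, smul_mul_assoc, ← hgw, mul_smul_comm, smul_mul_assoc, smul_smul,
      inv_mul_cancel₀ hq0, one_smul]
  have hprod : ∀ k, (q⁻¹ • w) k * (q⁻¹ • w) (σ k) = (Q : ℂ)⁻¹ := fun k => by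
    rw [Pi.smul_apply, Pi.smul_apply, smul_mul_smul_comm, hw, ← mul_inv, hqq, smul_eq_mul, mul_one]
  refine ⟨g, hg, q⁻¹ • w, hgz, fun k hk => ?_, ?_, hprod⟩
  · have := hprod k
    rw [hk, zero_mul] at this
    exact inv_ne_zero hQ0 this.symm
  generalize q⁻¹ • w = z at hgz
  have hgg : gᴴ * g = 1 := mem_unitaryGroup_iff'.mp hg
  have hgg' : gᵀ * gᵀᴴ = 1 := by
    have : (gᴴ * g)ᵀ = 1 := by rw [hgg, transpose_one]
    rwa [transpose_mul] at this
  -- `tr (X* X)` is unchanged under `X ↦ g X gᵀ`; on the monomial matrix it equals `∑ |z k|²`.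
  have h1 : trace ((g * V * gᵀ)ᴴ * (g * V * gᵀ)) = 1 := by
    rw [← htr, conjTranspose_mul, conjTranspose_mul]
    calc trace (gᵀᴴ * (Vᴴ * gᴴ) * (g * V * gᵀ))
        = trace (gᵀᴴ * (Vᴴ * (gᴴ * g) * V * gᵀ)) := by simp only [mul_assoc]
      _ = trace (Vᴴ * V * (gᵀ * gᵀᴴ)) := by rw [hgg, mul_one, trace_mul_comm, mul_assoc]
      _ = trace (Vᴴ * V) := by rw [hgg', mul_one]
  have h2 : trace ((g * V * gᵀ)ᴴ * (g * V * gᵀ)) = ((∑ k, ‖z k‖ ^ 2 : ℝ) : ℂ) := by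
    rw [hgz, trace_mul_comm, trace, Complex.ofReal_sum]
    refine Finset.sum_congr rfl fun k _ => ?_
    rw [diag_apply, mul_apply, Finset.sum_eq_single (σ k)]
    · simp [Equiv.Perm.permMatrix, PEquiv.toMatrix_apply, diagonal_mul, Complex.mul_conj']
    · intro j _ hj
      simp [Equiv.Perm.permMatrix, PEquiv.toMatrix_apply, diagonal_mul, hj.symm]
    · simp
  exact_mod_cast h2.symm.trans h1
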